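/- A digraph (finite; loops are allowed a priori, parallel arcs are not) is called $k$-geodetic if for any two (not necessarily distinct) vertices $u,v$ there is at most one directed walk from $u$ to $v$ of length at most $k$. Let $M(d,k)=1+d+d^2+\dots+d^k$. A $(d,k;+1)$-digraph is a $k$-geodetic digraph with minimum out-degree $d$ and exactly $M(d,k)+1$ vertices. Theorem. There are no $(5,2;+1)$-digraphs, no $(6,2;+1)$-digraphs and no $(7,2;+1)$-digraphs. That is, for $d\in\{5,6,7\}$ there is no $2$-geodetic digraph with minimum out-degree $d$ and order $M(d,2)+1=d^2+d+2$ (that is, order $32$, $44$ and $58$, respectively). -/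

import Mathlib

namespace Digraph

universe u

variable {V : Type u}

/-- Directed walks of a digraph from one vertex to another. -/
inductive Walk (G : Digraph V) : V → V → Type u
  | nil {x : V} : Walk G x x
  | cons {x y z : V} (h : G.Adj x y) (p : Walk G y z) : Walk G x z

/-- The length of a walk is its number of arcs. -/
def Walk.length {G : Digraph V} : {x y : V} → G.Walk x y → ℕ
  | _, _, .nil => 0
  | _, _, .cons _ p => p.length + 1

/-- A digraph is `k`-geodetic if between any two (not necessarily distinct) vertices there is at
most one directed walk of length at most `k`. -/
def IsGeodetic (G : Digraph V) (k : ℕ) : Prop :=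
  ∀ (x y : V) (p q : G.Walk x y), p.length ≤ k → q.length ≤ k → p = q

/-- The number of out-neighbours of a vertex (of a finite digraph). -/
noncomputable def outDegree (G : Digraph V) (x : V) : ℕ :=
  {y : V | G.Adj x y}.ncard

/-- The directed Moore bound `1 + d + d ^ 2 + ⋯ + d ^ k`. -/
def mooreBound (d k : ℕ) : ℕ :=
  ∑ i ∈ Finset.range (k + 1), d ^ i

/-- A `(d, k; +1)`-digraph: a finite `k`-geodetic digraph with minimum out-degree `d` and
excess one, that is, with order one more than the directed Moore bound. -/
structure IsExcessOne [Fintype V] (G : Digraph V) (d k : ℕ) : Prop where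
  isGeodetic : G.IsGeodetic k
  minOutDegree : IsLeast (Set.range G.outDegree) d
  order : Fintype.card V = mooreBound d k + 1

end Digraph

/-!
Let `A` be the adjacency matrix of a 2-geodetic digraph with minimum out-degree `d ≥ 2` and
`n = d ^ 2 + d + 2` vertices. Counting shows that all out-degrees are `d` and that each vertex `x`
fails to reach exactly one vertex `o x`, its outlier, by walks of length at most two. So
`A ^ 2 + A + 1 + P = J`, where `J` is the all-ones matrix and `P` is the matrix of the map `o`.

If the in-degrees are not all equal to `d`, then all outliers have the same out-neighbourhood
(`Digraph.IsExcessOne.sum_adjMat_col`), so that `A ^ 3 + A ^ 2 + A` vanishes modulo the constant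
vectors. A nonreal eigenvalue of the rational matrix `A` is as frequent as its conjugate, and the
traces of `A` and `A ^ 2` are zero; this forces `d ^ 2 = d` (`sq_eq_self_of_rows_eq`).

Otherwise `P` is a permutation matrix commuting with `A`, and `B = 2 * A + 1` squares to
`-3 - 4 * P` on the complement of the constant vectors. On the eigenspace of `P` for a root of unity
`ζ` the trace of `B` lies in `ℚ(ζ)` and is an integral multiple of a square root of `-3 - 4 * ζ`
(`Matrix.exists_trace_eq_int_mul`). Hence it is zero unless `-3 - 4 * ζ` is a square in `ℚ(ζ)`,
which happens only for `ζ` of order two or four (`eq_two_or_four_of_sq_eq`). The weight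
`4 + ζ + 3 * ζ ^ 3` removes these two exceptions (`trace_weight_eq_zero`), so that the trace of
`B * (4 + P + 3 * P ^ 3)` is the contribution `8 * (2 * d + 1)` of the constant vectors. As all these
matrices have nonnegative entries, it is also at least `4 * n`. So `n ≤ 4 * d + 2`
(`Digraph.IsExcessOne.card_le`), which is false for `d ≥ 4`.

The arithmetic statement amounts to the irreducibility over `ℚ(ζ)` of `x ^ 2 + x + 1 + ζ`. If the
order of `ζ` is squarefree, a root is excluded by a trace modulo two, and otherwise by the size of
the conjugates of `2 * x + 1`.
-/

section

open Polynomial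

/-! ### Squares in cyclotomic fields -/

theorem nextCoeff_cyclotomic (R : Type*) [CommRing R] [Nontrivial R] {n : ℕ} (hn : 0 < n) :
    (cyclotomic n R).nextCoeff = -(ArithmeticFunction.moebius n : R) := by
  have key : ∀ m > 0, ∑ i ∈ m.divisors, (-(cyclotomic i R).nextCoeff) =
      if m = 1 then 1 else 0 := by
    intro m hm
    rw [Finset.sum_neg_distrib, ← Monic.nextCoeff_prod _ _ fun i _ ↦ cyclotomic.monic i R,
      prod_cyclotomic_eq_X_pow_sub_one hm]
    have hd : (X ^ m - 1 : R[X]).natDegree = m := by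
      simpa using natDegree_X_pow_sub_C (R := R) (n := m) (r := 1)
    rw [nextCoeff_of_natDegree_pos (by omega), hd]
    rcases eq_or_ne m 1 with rfl | h
    · simp
    · simp [coeff_X_pow, coeff_one, h, show m - 1 ≠ m by omega, show m - 1 ≠ 0 by omega]
  have h2 := ArithmeticFunction.sum_eq_iff_sum_mul_moebius_eq.1 key n hn
  rw [← neg_eq_iff_eq_neg, ← h2, Finset.sum_eq_single (n, 1)]
  · simp
  · rintro ⟨a, b⟩ hab hne
    have : b ≠ 1 := by
      rintro rfl
      simp at hab
      exact hne (by simp [hab])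
    simp [this]
  · intro h
    simp [hn.ne'] at h

/-- The trace of an algebra over the field with two elements is invariant under the Frobenius map, so
it kills every `x ^ 2 + x`. -/
theorem trace_sq_eq_trace_zmod_two {R : Type*} [CommRing R] [Algebra (ZMod 2) R]
    (pb : PowerBasis (ZMod 2) R) (x : R) :
    Algebra.trace (ZMod 2) R (x ^ 2) = Algebra.trace (ZMod 2) R x := by
  rw [Algebra.trace_eq_matrix_trace pb.basis, Algebra.trace_eq_matrix_trace pb.basis, map_pow,
    ZMod.trace_pow_card, ZMod.pow_card]

/-- If `x ^ 2 + x + 1 + ζ = 0` with `x` in `ℤ[ζ]`, taking traces modulo two gives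
`φ n + μ n = 0`. This fails for squarefree `n > 2`, since then `φ n` is even and `μ n` is odd. -/
theorem not_dvd_of_squarefree {n : ℕ} (hn : 2 < n) (hsq : Squarefree n) (r : ℤ[X]) :
    ¬ cyclotomic n ℤ ∣ r ^ 2 + r + 1 + X := by
  intro hdvd
  set Φ : (ZMod 2)[X] := cyclotomic n (ZMod 2) with hΦ
  have hmon : Φ.Monic := cyclotomic.monic _ _
  set φ := AdjoinRoot.mk Φ
  have h0 : φ (r.map (Int.castRingHom _)) ^ 2 + φ (r.map (Int.castRingHom _)) + 1
      + AdjoinRoot.root Φ = 0 := by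
    have h := Polynomial.map_dvd (Int.castRingHom (ZMod 2)) hdvd
    rw [map_cyclotomic] at h
    have h' := AdjoinRoot.mk_eq_zero.2 h
    simpa [φ] using h'
  have ht := congrArg (Algebra.trace (ZMod 2) (AdjoinRoot Φ)) h0
  let pb := AdjoinRoot.powerBasis hmon.ne_zero
  have h1 : Algebra.trace (ZMod 2) (AdjoinRoot Φ) 1 = 0 := by
    rw [← map_one (algebraMap (ZMod 2) (AdjoinRoot Φ)), Algebra.trace_algebraMap_of_basis pb.basis]
    simp only [Fintype.card_fin, pb, AdjoinRoot.powerBasis_dim, hΦ, natDegree_cyclotomic]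
    obtain ⟨k, hk⟩ := Nat.totient_even hn
    rw [hk, ← two_mul, mul_smul, two_nsmul, CharTwo.add_self_eq_zero]
  have h2 : Algebra.trace (ZMod 2) (AdjoinRoot Φ) (AdjoinRoot.root Φ) = 1 := by
    have : Nontrivial (AdjoinRoot Φ) := AdjoinRoot.nontrivial Φ (by
      rw [hΦ, degree_cyclotomic]
      exact_mod_cast (Nat.totient_pos.2 (by omega)).ne')
    have := pb.trace_gen_eq_nextCoeff_minpoly
    rw [show pb.gen = AdjoinRoot.root Φ from AdjoinRoot.powerBasis_gen _,
      AdjoinRoot.minpoly_root hmon.ne_zero, hmon.leadingCoeff, inv_one, C_1, mul_one,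
      nextCoeff_cyclotomic (ZMod 2) (by omega),
      ArithmeticFunction.moebius_apply_of_squarefree hsq] at this
    rw [this]
    rcases neg_one_pow_eq_or ℤ (ArithmeticFunction.cardFactors n) with h | h <;> rw [h] <;> rfl
  simp only [map_add, trace_sq_eq_trace_zmod_two pb, CharTwo.add_self_eq_zero, h1, h2,
    map_zero] at ht
  simp at ht

theorem cyclotomic_dvd_of_aeval_eq_zero {n : ℕ} (hn : 0 < n) {K : Type*} [Field K] [CharZero K]
    {ω : K} (hω : IsPrimitiveRoot ω n) {f : ℤ[X]} (h : aeval ω f = 0) : cyclotomic n ℤ ∣ f := by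
  rw [cyclotomic_eq_minpoly hω hn]
  exact minpoly.isIntegrallyClosed_dvd (hω.isIntegral hn) h

theorem aeval_eq_zero_of_cyclotomic_dvd {n : ℕ} (hn : 0 < n) {K : Type*} [Field K] [CharZero K]
    {ω : K} (hω : IsPrimitiveRoot ω n) {f : ℤ[X]} (h : cyclotomic n ℤ ∣ f) : aeval ω f = 0 := by
  obtain ⟨g, rfl⟩ := h
  rw [cyclotomic_eq_minpoly hω hn, map_mul, minpoly.aeval, zero_mul]

/-- The norm of a nonzero cyclotomic integer is a nonzero integer, so by the inequality between
arithmetic and geometric means its conjugates have mean square absolute value at least one. -/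
theorem card_le_sum_normSq_aeval {n : ℕ} [NeZero n] (f : ℤ[X])
    (h : ∀ ω ∈ primitiveRoots n ℂ, aeval ω f ≠ 0) :
    ((primitiveRoots n ℂ).card : ℝ) ≤
      ∑ ω ∈ primitiveRoots n ℂ, Complex.normSq (aeval ω f) := by
  obtain ⟨D, hD⟩ : ∃ D : ℤ, ∏ ω ∈ primitiveRoots n ℂ, aeval ω f = (D : ℂ) := by
    -- The norm is expressed as a resultant with the cyclotomic polynomial.
    refine ⟨resultant (cyclotomic n ℤ) f, ?_⟩
    have h1 := resultant_eq_prod_eval (cyclotomic n ℂ) (f.map (Int.castRingHom ℂ)) f.natDegree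
      natDegree_map_le (IsAlgClosed.splits _)
    rw [(cyclotomic.monic n ℂ).leadingCoeff, one_pow, one_mul,
      cyclotomic.roots_eq_primitiveRoots_val, ← map_cyclotomic_int n ℂ, resultant_map_map,
      (cyclotomic.monic n ℤ).natDegree_map] at h1
    rw [eq_intCast] at h1
    rw [h1, Finset.prod]
    simp [aeval_def, eval_map]
  have hD0 : D ≠ 0 := by
    rintro rfl
    rw [Int.cast_zero, Finset.prod_eq_zero_iff] at hD
    obtain ⟨ω, hω, h0⟩ := hD
    exact h ω hω h0
  have hprod : 1 ≤ ∏ ω ∈ primitiveRoots n ℂ, Complex.normSq (aeval ω f) := by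
    rw [← map_prod, hD, Complex.normSq_intCast]
    exact_mod_cast Int.one_le_abs (mul_ne_zero hD0 hD0) |>.trans_eq (abs_mul_self D)
  have hpos : ∀ ω ∈ primitiveRoots n ℂ, 0 < Complex.normSq (aeval ω f) :=
    fun ω hω ↦ Complex.normSq_pos.2 (h ω hω)
  have hlog := Real.log_nonneg hprod
  rw [Real.log_prod fun ω hω ↦ (hpos ω hω).ne'] at hlog
  have := Finset.sum_le_sum fun ω hω ↦ Real.log_le_sub_one_of_pos (hpos ω hω)
  rw [Finset.sum_sub_distrib, Finset.sum_const, nsmul_one] at this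
  linarith

/-- When `p ^ 2` divides `n`, multiplication by `p`-th roots of unity preserves primitive `n`-th roots
of unity. -/
theorem mul_mem_primitiveRoots {n p : ℕ} (hn : 0 < n) (hp : 0 < p) (hpn : p * p ∣ n) {η ω : ℂ}
    (hη : η ^ p = 1) (hω : ω ∈ primitiveRoots n ℂ) : η * ω ∈ primitiveRoots n ℂ := by
  rw [mem_primitiveRoots hn] at hω ⊢
  obtain ⟨m, rfl⟩ := hpn
  constructor
  · rw [mul_pow, hω.pow_eq_one, mul_assoc, pow_mul, hη, one_pow, one_mul]
  · intro l hl
    have h1 : ω ^ (p * l) = 1 := by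
      calc ω ^ (p * l) = (η ^ p) ^ l * ω ^ (p * l) := by rw [hη]; simp
        _ = ((η * ω) ^ l) ^ p := by ring
        _ = 1 := by rw [hl, one_pow]
    have h2 : p * m ∣ l := by
      have := hω.dvd_of_pow_eq_one _ h1
      rwa [mul_assoc, Nat.mul_dvd_mul_iff_left hp] at this
    have h3 : η ^ l = 1 := by
      obtain ⟨k, rfl⟩ := (Dvd.intro m rfl : p ∣ p * m).trans h2
      rw [pow_mul, hη, one_pow]
    rw [mul_pow, h3, one_mul] at hl
    exact hω.dvd_of_pow_eq_one _ hl

theorem sum_primitiveRoots_mul {n p : ℕ} (hn : 0 < n) (hp : 0 < p) (hpn : p * p ∣ n) {η : ℂ}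
    (hη : η ^ p = 1) (g : ℂ → ℂ) :
    ∑ ω ∈ primitiveRoots n ℂ, g (η * ω) = ∑ ω ∈ primitiveRoots n ℂ, g ω := by
  have hη0 : η ≠ 0 := by
    rintro rfl
    simp [hp.ne'] at hη
  have hinj : Function.Injective (η * ·) := mul_right_injective₀ hη0
  have himg : (primitiveRoots n ℂ).image (η * ·) = primitiveRoots n ℂ := by
    refine Finset.eq_of_subset_of_card_le ?_ (Finset.card_image_of_injective _ hinj).ge
    intro x hx
    obtain ⟨ω, hω, rfl⟩ := Finset.mem_image.1 hx
    exact mul_mem_primitiveRoots hn hp hpn hη hω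
  conv_rhs => rw [← himg, Finset.sum_image hinj.injOn]

theorem sum_primitiveRoots_eq_zero_of_twist {n p : ℕ} (hn : 0 < n) (hp : 0 < p) (hpn : p * p ∣ n)
    {η c : ℂ} (hη : η ^ p = 1) (hc : c ≠ 1) (g : ℂ → ℂ)
    (hg : ∀ ω ∈ primitiveRoots n ℂ, g (η * ω) = c * g ω) :
    ∑ ω ∈ primitiveRoots n ℂ, g ω = 0 := by
  have h := sum_primitiveRoots_mul hn hp hpn hη g
  rw [Finset.sum_congr rfl hg, ← Finset.mul_sum] at h
  have : (c - 1) * ∑ ω ∈ primitiveRoots n ℂ, g ω = 0 := by rw [sub_mul, h, one_mul, sub_self]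
  exact (mul_eq_zero.1 this).resolve_left (sub_ne_zero.2 hc)

open ComplexConjugate in
/-- Let `x ^ 2 + x + 1 + ζ = 0` with `x` in `ℤ[ζ]` and `p ^ 2 ∣ n`. Split `x = x₀ + x₁` according to
whether the exponents of `ζ` are divisible by `p`. The two parts are orthogonal on average over the
conjugates, so if `x₁ ≠ 0` the mean of `|2 * x + 1| ^ 2` is at least `1 + 4 = 5`. On the other hand
`|2 * x + 1| ^ 2 = |3 + 4 * ζ|`, whose mean is less than `5` except for `n = 4`. If `x₁ = 0`, then
`x`, and hence `ζ`, is invariant under `ζ ↦ η * ζ` for a primitive `p`-th root of unity `η`. -/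
theorem not_dvd_of_not_squarefree {n : ℕ} (hn : 0 < n) (h4 : n ≠ 4) (hsq : ¬ Squarefree n)
    (r : ℤ[X]) : ¬ cyclotomic n ℤ ∣ r ^ 2 + r + 1 + X := by
  intro hdvd
  have : NeZero n := ⟨hn.ne'⟩
  obtain ⟨p, hp, hpn⟩ : ∃ p, p.Prime ∧ p * p ∣ n := by
    simpa [Nat.squarefree_iff_prime_squarefree] using hsq
  set W := primitiveRoots n ℂ
  have hprim : ∀ ω ∈ W, IsPrimitiveRoot ω n := fun ω hω ↦ (mem_primitiveRoots hn).1 hω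
  obtain ⟨ω₀, hω₀⟩ : W.Nonempty :=
    ⟨_, (mem_primitiveRoots hn).2 (Complex.isPrimitiveRoot_exp n hn.ne')⟩
  obtain ⟨η, hη⟩ : ∃ η : ℂ, IsPrimitiveRoot η p := ⟨_, Complex.isPrimitiveRoot_exp p hp.ne_zero⟩
  have heq : ∀ ω ∈ W, aeval ω r ^ 2 + aeval ω r + 1 + ω = 0 := fun ω hω ↦ by
    simpa using aeval_eq_zero_of_cyclotomic_dvd hn (hprim ω hω) hdvd
  set r₀ : ℤ[X] := ∑ k ∈ r.support with p ∣ k, monomial k (r.coeff k) with hr₀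
  set r₁ : ℤ[X] := ∑ k ∈ r.support with ¬ p ∣ k, monomial k (r.coeff k) with hr₁
  have hr : r₀ + r₁ = r := by
    rw [hr₀, hr₁, Finset.sum_filter_add_sum_filter_not]
    exact r.as_sum_support.symm
  have hr₀η (ω : ℂ) : aeval (η * ω) r₀ = aeval ω r₀ := by
    simp only [hr₀, map_sum, aeval_monomial]
    refine Finset.sum_congr rfl fun k hk ↦ ?_
    rw [mul_pow, (hη.pow_eq_one_iff_dvd k).2 (Finset.mem_filter.1 hk).2, one_mul]
  have hne₁ : ∀ ω ∈ W, aeval ω r₁ ≠ 0 := by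
    intro ω hω h0
    have hω' := mul_mem_primitiveRoots hn hp.pos hpn hη.pow_eq_one hω
    have h1 := cyclotomic_dvd_of_aeval_eq_zero hn (hprim ω hω) h0
    have h2 := aeval_eq_zero_of_cyclotomic_dvd hn (hprim _ hω') h1
    have e1 := heq ω hω
    have e2 := heq _ hω'
    rw [← hr, map_add, h0, add_zero] at e1
    rw [← hr, map_add, h2, add_zero, hr₀η] at e2
    have : (η - 1) * ω = 0 := by linear_combination e2 - e1
    rcases mul_eq_zero.1 this with h | h
    · exact hη.ne_one hp.one_lt (sub_eq_zero.1 h)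
    · exact (hprim ω hω).ne_zero hn.ne' h
  -- Modulo two, `2 * r₀ + 1` becomes `1`, so it has no cyclotomic factor.
  have hne₀ : ∀ ω ∈ W, aeval ω (2 * r₀ + 1) ≠ 0 := by
    intro ω hω h0
    have h1 := Polynomial.map_dvd (Int.castRingHom (ZMod 2))
      (cyclotomic_dvd_of_aeval_eq_zero hn (hprim ω hω) h0)
    have h2 : Polynomial.map (Int.castRingHom (ZMod 2)) (2 * r₀ + 1) = 1 := by
      simp [Polynomial.map_ofNat, show (2 : (ZMod 2)[X]) = 0 from CharTwo.two_eq_zero]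
    rw [map_cyclotomic, h2] at h1
    have h3 := natDegree_eq_zero_of_isUnit (isUnit_of_dvd_one h1)
    rw [natDegree_cyclotomic] at h3
    exact (Nat.totient_pos.2 hn).ne' h3
  have hcross : ∑ ω ∈ W, aeval ω (2 * r₀ + 1) * conj (aeval ω r₁) = 0 := by
    simp only [hr₁, map_sum, aeval_monomial, Finset.mul_sum]
    rw [Finset.sum_comm]
    refine Finset.sum_eq_zero fun k hk ↦ ?_
    refine sum_primitiveRoots_eq_zero_of_twist hn hp.pos hpn hη.pow_eq_one
      (c := conj (η ^ k)) ?_ _ fun ω _ ↦ ?_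
    · rw [ne_eq, map_eq_one_iff _ (starRingEnd ℂ).injective, hη.pow_eq_one_iff_dvd]
      exact (Finset.mem_filter.1 hk).2
    · simp only [map_add, map_mul, hr₀η, map_ofNat, map_one, mul_pow]
      ring
  have hsum : ∑ ω ∈ W, Complex.normSq (aeval ω (2 * r + 1)) =
      ∑ ω ∈ W, Complex.normSq (aeval ω (2 * r₀ + 1)) +
        4 * ∑ ω ∈ W, Complex.normSq (aeval ω r₁) := by
    have : ∀ ω ∈ W, Complex.normSq (aeval ω (2 * r + 1)) =
        Complex.normSq (aeval ω (2 * r₀ + 1)) + 4 * Complex.normSq (aeval ω r₁) +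
          4 * (aeval ω (2 * r₀ + 1) * conj (aeval ω r₁)).re := by
      intro ω _
      rw [← hr, show 2 * (r₀ + r₁) + 1 = (2 * r₀ + 1) + 2 * r₁ by ring, map_add,
        Complex.normSq_add, map_mul (aeval ω) 2 r₁, map_ofNat, map_mul, map_mul,
        Complex.normSq_ofNat, map_ofNat]
      rw [show ∀ a b : ℂ, a * (2 * b) = ((2 : ℝ) : ℂ) * (a * b) by intros; push_cast; ring,
        Complex.re_ofReal_mul]
      ring
    rw [Finset.sum_congr rfl this, Finset.sum_add_distrib, Finset.sum_add_distrib,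
      ← Finset.mul_sum, ← Finset.mul_sum, ← Complex.re_sum, hcross]
    simp
  have hre : ∑ ω ∈ W, ω.re = 0 := by
    have := sum_primitiveRoots_eq_zero_of_twist hn hp.pos hpn hη.pow_eq_one
      (hη.ne_one hp.one_lt) id fun ω _ ↦ rfl
    rw [← Complex.re_sum]
    simpa using congrArg Complex.re this
  have hlt : ∀ ω ∈ W, Complex.normSq (aeval ω (2 * r + 1)) < 5 + 12 / 5 * ω.re := by
    intro ω hω
    have hnorm : ω.re * ω.re + ω.im * ω.im = 1 := by
      rw [← Complex.normSq_apply, Complex.normSq_eq_norm_sq, (hprim ω hω).norm'_eq_one hn.ne',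
        one_pow]
    -- The square of `t` is `|3 + 4 * ω| ^ 2 = 25 + 24 * re ω`, and `t < (25 + t ^ 2) / 10` unless
    -- `t = 5`, in which case `ω` is a primitive fourth root of unity.
    set t := Complex.normSq (aeval ω (2 * r + 1)) with ht
    have htt : t ^ 2 = 25 + 24 * ω.re := by
      have : aeval ω (2 * r + 1) ^ 2 = -(3 + 4 * ω) := by
        simp only [map_add, map_mul, map_ofNat, map_one]
        linear_combination 4 * heq ω hω
      rw [ht, ← map_pow, this, Complex.normSq_neg, Complex.normSq_apply]
      simp
      linear_combination 16 * hnorm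
    have ht5 : t ≠ 5 := by
      intro h5
      have h0 : ω.re = 0 := by rw [h5] at htt; linarith
      have hi : ω ^ 2 = -1 := by
        apply Complex.ext <;> simp [pow_two, h0]
        rw [h0] at hnorm; linarith
      have : n ∣ 4 := (hprim ω hω).dvd_of_pow_eq_one 4 (by
        rw [show 4 = 2 * 2 from rfl, pow_mul, hi]; norm_num)
      have hn4 := Nat.le_of_dvd (by norm_num) this
      interval_cases n
      · exact hsq squarefree_one
      · exact hsq Nat.prime_two.prime.squarefree
      · norm_num at this
      · exact h4 rfl
    have := sq_pos_of_ne_zero (sub_ne_zero.2 ht5)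
    nlinarith
  have h1 := Finset.sum_lt_sum_of_nonempty ⟨ω₀, hω₀⟩ hlt
  rw [hsum, Finset.sum_add_distrib, ← Finset.mul_sum, hre, Finset.sum_const, nsmul_eq_mul] at h1
  have h2 := card_le_sum_normSq_aeval _ hne₀
  have h3 := card_le_sum_normSq_aeval _ hne₁
  linarith

/-- If `x ^ 2 = -3 - 4 * z`, then `(x - 1) / 2` is an algebraic integer, hence an integral polynomial
in the root of unity `z`. -/
theorem exists_cyclotomic_dvd_of_sq_eq {n : ℕ} [NeZero n] {K : Type*} [Field K] [CharZero K]
    [IsCyclotomicExtension {n} ℚ K] {z : K} (hz : IsPrimitiveRoot z n) {x : K}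
    (hx : x ^ 2 = -3 - 4 * z) : ∃ r : ℤ[X], cyclotomic n ℤ ∣ r ^ 2 + r + 1 + X := by
  have hn : 0 < n := NeZero.pos n
  set y : K := (x - 1) / 2 with hy
  have hyz : y ^ 2 + y + 1 + z = 0 := by
    rw [hy]
    linear_combination hx / 4
  have hyint : IsIntegral ℤ y := by
    have hmon : (X ^ 2 + X + 1 : ℤ[X]).Monic := by monicity!
    refine IsIntegral.of_aeval_monic hmon (by
      rw [show (X ^ 2 + X + 1 : ℤ[X]).natDegree = 2 by compute_degree!]; norm_num) ?_
    have : aeval y (X ^ 2 + X + 1 : ℤ[X]) = -z := by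
      simp only [map_add, map_pow, map_one, aeval_X]
      linear_combination hyz
    rw [this]
    exact (hz.isIntegral hn).neg
  obtain ⟨r, hr⟩ : ∃ r : ℤ[X], aeval z r = y := by
    have := IsCyclotomicExtension.Rat.isIntegralClosure_adjoin_singleton hz
    obtain ⟨⟨w, hw⟩, hw'⟩ := (this.isIntegral_iff (x := y)).1 hyint
    rw [Algebra.adjoin_singleton_eq_range_aeval] at hw
    obtain ⟨r, hr⟩ := hw
    exact ⟨r, hr.trans hw'⟩
  refine ⟨r, cyclotomic_dvd_of_aeval_eq_zero hn hz ?_⟩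
  simp only [map_add, map_pow, map_one, aeval_X]
  rw [hr, hyz]

/-- For a root of unity `ζ` the number `-3 - 4 * ζ` is a square in `ℚ(ζ)` only if `ζ` has order two or
four, where `-3 - 4 * ζ` is `1` and `(1 - 2 * ζ) ^ 2` respectively. -/
theorem eq_two_or_four_of_sq_eq {n : ℕ} (hn : 0 < n) {ζ : ℂ} (hζ : IsPrimitiveRoot ζ n)
    (q : ℚ[X]) (hq : aeval ζ q ^ 2 = -3 - 4 * ζ) : n = 2 ∨ n = 4 := by
  by_contra! hcon
  have : NeZero n := ⟨hn.ne'⟩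
  have : IsCyclotomicExtension {n} ℚ (CyclotomicField n ℚ) :=
    CyclotomicField.isCyclotomicExtension n ℚ
  have hz := IsCyclotomicExtension.zeta_spec n ℚ (CyclotomicField n ℚ)
  set z := IsCyclotomicExtension.zeta n ℚ (CyclotomicField n ℚ)
  have hqz : aeval z q ^ 2 = -3 - 4 * z := by
    have h1 : minpoly ℚ ζ ∣ q ^ 2 + 3 + 4 * X := by
      apply minpoly.dvd
      simp only [map_add, map_mul, map_pow, map_ofNat, aeval_X, hq]
      ring
    rw [← cyclotomic_eq_minpoly_rat hζ hn, cyclotomic_eq_minpoly_rat hz hn] at h1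
    have h2 := aeval_eq_zero_of_dvd_aeval_eq_zero h1 (minpoly.aeval ℚ z)
    simp only [map_add, map_mul, map_pow, map_ofNat, aeval_X] at h2
    linear_combination h2
  obtain ⟨r, hdvd⟩ := exists_cyclotomic_dvd_of_sq_eq hz hqz
  by_cases hsq : Squarefree n
  · rcases (show n = 1 ∨ 2 < n by omega) with rfl | h
    · rw [cyclotomic_one] at hdvd
      have := eval_dvd (x := 1) hdvd
      simp at this
      nlinarith [sq_nonneg (2 * r.eval 1 + 1)]
    · exact not_dvd_of_squarefree h hsq r hdvd
  · exact not_dvd_of_not_squarefree hn hcon.2 hsq r hdvd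

/-! ### Traces on eigenspaces -/

open Matrix in
theorem Matrix.exists_natCast_eq_trace_of_isIdempotentElem {V : Type*} [Fintype V] [DecidableEq V]
    {K : Type*} [Field K] {E : Matrix V V K} (hE : IsIdempotentElem E) :
    ∃ k : ℕ, E.trace = k := by
  have h : IsIdempotentElem (Matrix.toLin' E) := by
    rw [IsIdempotentElem, Module.End.mul_eq_comp, ← Matrix.toLin'_mul, hE.eq]
  rw [← Matrix.trace_toLin'_eq]
  exact ⟨_, ((LinearMap.isProj_range_iff_isIdempotentElem _).2 h).trace⟩

/-- If `F` squares to `s ^ 2` on the image of a projection `E` and vanishes on its kernel, its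
eigenvalues on that image are `± s`, so that its trace is an integral multiple of `s`. -/
theorem Matrix.exists_trace_eq_int_mul {V : Type*} [Fintype V] [DecidableEq V]
    {K : Type*} [Field K] [CharZero K] {E F : Matrix V V K} {s : K} (hs : s ≠ 0)
    (hE : IsIdempotentElem E) (hEF : E * F = F) (hFE : F * E = F) (hF : F * F = s ^ 2 • E) :
    ∃ g : ℤ, F.trace = g * s := by
  -- The projection onto the eigenspace of `F` for the eigenvalue `s`.
  have hQ : IsIdempotentElem ((2⁻¹ : K) • (E + s⁻¹ • F)) := by
    rw [IsIdempotentElem]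
    simp only [smul_mul_assoc, mul_smul_comm, mul_add, add_mul, hE.eq, hEF, hFE, hF, smul_smul,
      smul_add]
    rw [show 2⁻¹ * s⁻¹ * (2⁻¹ * s⁻¹ * s ^ 2) = (2⁻¹ * 2⁻¹ : K) by field_simp]
    module
  obtain ⟨a, ha⟩ := exists_natCast_eq_trace_of_isIdempotentElem hQ
  obtain ⟨b, hb⟩ := exists_natCast_eq_trace_of_isIdempotentElem hE
  refine ⟨2 * a - b, ?_⟩
  rw [trace_smul, trace_add, trace_smul, hb, smul_eq_mul, smul_eq_mul] at ha
  push_cast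
  rw [← ha]
  field_simp
  ring

section Isotypic

variable {R : Type*} [Ring R] [Algebra ℂ R]

/-- The spectral projection of an element of order dividing `N` onto the eigenvalue `ζ`, written
in terms of the inverse `Q` of that element. -/
noncomputable def isotypicProj (N : ℕ) (Q : R) (ζ : ℂ) : R :=
  (N : ℂ)⁻¹ • ∑ k ∈ Finset.range N, ζ ^ k • Q ^ k

variable {N : ℕ} {P Q : R} {ζ : ℂ}

/-- The sum defining the projection is a full geometric sum in `ζ • Q`, whose `N`-th power is one. -/
theorem smul_mul_isotypicProj (hζ : ζ ^ N = 1) (hQ : Q ^ N = 1) :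
    ζ • Q * isotypicProj N Q ζ = isotypicProj N Q ζ := by
  rw [isotypicProj, mul_smul_comm]
  congr 1
  simp only [← _root_.smul_pow]
  have h1 := Finset.sum_range_succ (fun k ↦ (ζ • Q) ^ k) N
  rw [Finset.sum_range_succ', _root_.smul_pow ζ Q N, hζ, hQ, one_smul, pow_zero] at h1
  rw [Finset.mul_sum, ← add_right_cancel h1]
  simp only [pow_succ']

theorem mul_isotypicProj (hζ : ζ ^ N = 1) (hQ : Q ^ N = 1) (hPQ : P * Q = 1) :
    P * isotypicProj N Q ζ = ζ • isotypicProj N Q ζ := by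
  conv_lhs => rw [← smul_mul_isotypicProj hζ hQ, ← mul_assoc, mul_smul_comm, hPQ, smul_mul_assoc,
    one_mul]

theorem isIdempotentElem_isotypicProj (hN : N ≠ 0) (hζ : ζ ^ N = 1) (hQ : Q ^ N = 1) :
    IsIdempotentElem (isotypicProj N Q ζ) := by
  have h : ∀ k, (ζ • Q) ^ k * isotypicProj N Q ζ = isotypicProj N Q ζ := by
    intro k
    induction k with
    | zero => simp
    | succ k ih => rw [pow_succ, mul_assoc, smul_mul_isotypicProj hζ hQ, ih]
  rw [IsIdempotentElem]
  nth_rw 1 [isotypicProj]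
  simp only [← _root_.smul_pow]
  rw [smul_mul_assoc, Finset.sum_mul, Finset.sum_congr rfl fun k _ ↦ h k, Finset.sum_const,
    Finset.card_range, ← Nat.cast_smul_eq_nsmul ℂ, smul_smul,
    inv_mul_cancel₀ (Nat.cast_ne_zero.2 hN), one_smul]

theorem Commute.isotypicProj_right {M : R} (h : Commute M Q) : Commute M (isotypicProj N Q ζ) :=
  (Commute.sum_right _ _ _ fun k _ ↦ (h.pow_right k).smul_right _).smul_right _

theorem sum_isotypicProj {ω : ℂ} (hN : N ≠ 0) (hω : IsPrimitiveRoot ω N) :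
    ∑ i ∈ Finset.range N, isotypicProj N Q (ω ^ i) = 1 := by
  simp only [isotypicProj]
  rw [← Finset.smul_sum, Finset.sum_comm]
  simp only [← Finset.sum_smul]
  rw [Finset.sum_eq_single 0]
  · simp only [pow_zero, Finset.sum_const, Finset.card_range, nsmul_one]
    rw [smul_smul, inv_mul_cancel₀ (Nat.cast_ne_zero.2 hN), one_smul]
  · intro k hk hk0
    have hne : ω ^ k ≠ 1 := fun h ↦
      Nat.not_dvd_of_pos_of_lt (Nat.pos_of_ne_zero hk0) (Finset.mem_range.1 hk)
        (hω.dvd_of_pow_eq_one k h)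
    have h0 : ∑ i ∈ Finset.range N, (ω ^ i) ^ k = 0 := by
      simp only [← pow_mul, mul_comm _ k]
      simp only [pow_mul]
      rw [geom_sum_eq hne, ← pow_mul, mul_comm, pow_mul, hω.pow_eq_one]
      simp
    rw [h0, zero_smul]
  · intro h
    exact absurd (Finset.mem_range.2 (Nat.pos_of_ne_zero hN)) h

end Isotypic

/-- The weight `4 + ζ + 3 * ζ ^ 3` is chosen so that it vanishes at `ζ = -1` and so that its product
with `1 - 2 * ζ` is purely imaginary for `ζ` of order four; for all other orders `τ = 0`. -/
theorem re_weight_mul_eq_zero {N : ℕ} (hN : N ≠ 0) {ζ s τ : ℂ} (hζ : ζ ^ N = 1)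
    (hs : s ^ 2 = -3 - 4 * ζ) {g : ℤ} (hg : τ = g * s) {h : ℚ[X]} (hh : τ = aeval ζ h) :
    ((4 + ζ + 3 * ζ ^ 3) * τ).re = 0 := by
  rcases eq_or_ne g 0 with rfl | hg0
  · simp [hg]
  have hgC : (g : ℂ) ≠ 0 := Int.cast_ne_zero.2 hg0
  have hsq : aeval ζ (C ((g : ℚ)⁻¹) * h) ^ 2 = -3 - 4 * ζ := by
    rw [map_mul, ← hh, hg, aeval_C, ← hs]
    simp [hgC]
  have hfin : 0 < orderOf ζ := orderOf_pos_iff.2 (isOfFinOrder_iff_pow_eq_one.2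
    ⟨N, Nat.pos_of_ne_zero hN, hζ⟩)
  rcases eq_two_or_four_of_sq_eq hfin (IsPrimitiveRoot.orderOf ζ) _ hsq with h2 | h4
  · have hm : ζ = -1 := by
      have := IsPrimitiveRoot.orderOf ζ
      rw [h2] at this
      exact this.eq_neg_one_of_two_right
    rw [hm]
    norm_num
  · have hm : ζ ^ 2 = -1 := by
      have := IsPrimitiveRoot.orderOf ζ
      rw [h4] at this
      exact (this.pow (by norm_num) (show 4 = 2 * 2 by norm_num)).eq_neg_one_of_two_right
    have hre : ζ.re = 0 := by
      have h1 := congrArg Complex.re hm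
      have h2 := congrArg Complex.im hm
      simp [pow_two] at h1 h2
      rcases (show ζ.re = 0 ∨ ζ.im = 0 by
        rcases mul_eq_zero.1 (show ζ.re * ζ.im = 0 by linarith) with h | h
        · exact Or.inl h
        · exact Or.inr h) with h | h
      · exact h
      · rw [h] at h1; nlinarith
    have hs' : (s - (1 - 2 * ζ)) * (s + (1 - 2 * ζ)) = 0 := by
      linear_combination hs - 4 * hm
    have key : (4 + ζ + 3 * ζ ^ 3) * (1 - 2 * ζ) = -10 * ζ := by
      linear_combination (-6 * ζ ^ 2 + 3 * ζ + 4) * hm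
    rcases mul_eq_zero.1 hs' with h | h
    · have : (4 + ζ + 3 * ζ ^ 3) * τ = ((-10 * g : ℤ) : ℂ) * ζ := by
        rw [hg, sub_eq_zero.1 h]; push_cast; linear_combination g * key
      rw [this, ← Complex.ofReal_intCast, Complex.re_ofReal_mul, hre, mul_zero]
    · have : (4 + ζ + 3 * ζ ^ 3) * τ = ((10 * g : ℤ) : ℂ) * ζ := by
        rw [hg, eq_neg_of_add_eq_zero_left h]; push_cast; linear_combination - g * key
      rw [this, ← Complex.ofReal_intCast, Complex.re_ofReal_mul, hre, mul_zero]

/-- If `M` squares to `-3 - 4 * P` on the image of a projection, with `P` of finite order, then on each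
eigenspace of `P` the trace of `M` is an integral multiple of a square root of `-3 - 4 * ζ` and a
rational polynomial in the eigenvalue `ζ`. Summing over all eigenvalues with the weight
`4 + ζ + 3 * ζ ^ 3` therefore gives a purely imaginary number, which is rational and so zero. -/
theorem trace_weight_eq_zero {V : Type*} [Fintype V] [DecidableEq V] {N : ℕ} (hN : N ≠ 0)
    {P M E : Matrix V V ℚ} (hP : P ^ N = 1) (hE : IsIdempotentElem E) (hEP : Commute E P)
    (hMP : Commute M P) (hEM : E * M = M) (hME : M * E = M) (hM : M * M = -(3 + 4 * P) * E) :
    (M * (4 + P + 3 * P ^ 3)).trace = 0 := by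
  set φ : Matrix V V ℚ →+* Matrix V V ℂ := (algebraMap ℚ ℂ).mapMatrix with hφ
  have htr (X : Matrix V V ℚ) : (φ X).trace = (X.trace : ℂ) := by
    simp [hφ, Matrix.trace]
  set Q := P ^ (N - 1) with hQ
  have hPQ : P * Q = 1 := by rw [hQ, mul_pow_sub_one hN, hP]
  have hQN : Q ^ N = 1 := by rw [hQ, ← pow_mul, mul_comm, pow_mul, hP, one_pow]
  have hPQ' : φ P * φ Q = 1 := by rw [← map_mul, hPQ, map_one]
  have hQN' : φ Q ^ N = 1 := by rw [← map_pow, hQN, map_one]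
  have hMQ : Commute (φ M) (φ Q) := (hMP.pow_right _).map φ
  have hEQ : Commute (φ E) (φ Q) := (hEP.pow_right _).map φ
  have hω := Complex.isPrimitiveRoot_exp N hN
  set ω := Complex.exp (2 * Real.pi * Complex.I / N)
  set e : ℂ → Matrix V V ℂ := isotypicProj N (φ Q) with he
  have hroot : ∀ i, (ω ^ i) ^ N = 1 := fun i ↦ by
    rw [← pow_mul, mul_comm, pow_mul, hω.pow_eq_one, one_pow]
  have hPe : ∀ ζ : ℂ, ζ ^ N = 1 → φ P * e ζ = ζ • e ζ := fun ζ hζ ↦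
    mul_isotypicProj hζ hQN' hPQ'
  have hterm : ∀ ζ : ℂ, ζ ^ N = 1 → ((4 + ζ + 3 * ζ ^ 3) * (φ M * e ζ).trace).re = 0 := by
    intro ζ hζ
    have hMe : φ M * e ζ = e ζ * φ M := hMQ.isotypicProj_right
    have hEe : φ E * e ζ = e ζ * φ E := hEQ.isotypicProj_right
    have hee : e ζ * e ζ = e ζ := isIdempotentElem_isotypicProj hN hζ hQN'
    obtain ⟨s, hs⟩ := IsAlgClosed.exists_pow_nat_eq (-3 - 4 * ζ) (n := 2) (by norm_num)
    -- As `|4 * ζ| = 4`, the number `-3 - 4 * ζ` is nonzero.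
    have hs0 : s ≠ 0 := by
      rintro rfl
      have h1 : 4 * ζ = -3 := by linear_combination hs
      have h2 := congrArg norm h1
      rw [norm_mul, Complex.norm_eq_one_of_pow_eq_one hζ hN] at h2
      norm_num at h2
    have hE' : φ E * φ E = φ E := by rw [← map_mul, hE.eq]
    have hEM' : φ E * φ M = φ M := by rw [← map_mul, hEM]
    have hME' : φ M * φ E = φ M := by rw [← map_mul, hME]
    have hM' : φ M * φ M = -(3 + 4 * φ P) * φ E := by
      rw [← map_mul, hM]
      simp only [map_mul, map_neg, map_add, map_ofNat]
    obtain ⟨g, hg⟩ := Matrix.exists_trace_eq_int_mul (E := φ E * e ζ) (F := φ M * e ζ) hs0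
      (by rw [IsIdempotentElem, hEe, mul_assoc, ← mul_assoc (φ E), hEe, mul_assoc, hE',
            ← mul_assoc, hee])
      (by rw [mul_assoc, ← mul_assoc (e ζ), ← hMe, mul_assoc, hee, ← mul_assoc, hEM'])
      (by rw [mul_assoc, ← mul_assoc (e ζ), ← hEe, mul_assoc, hee, ← mul_assoc, hME'])
      (by
        rw [mul_assoc, ← mul_assoc (e ζ), ← hMe, mul_assoc, hee, ← mul_assoc, hM', hs, mul_assoc,
          hEe, ← mul_assoc, neg_mul, add_mul, mul_assoc, hPe ζ hζ]
        rw [← hEe, show (3 : Matrix V V ℂ) = algebraMap ℂ _ 3 from (map_ofNat _ 3).symm,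
          show (4 : Matrix V V ℂ) = algebraMap ℂ _ 4 from (map_ofNat _ 4).symm, ← Algebra.smul_def,
          ← Algebra.smul_def, smul_smul, ← add_smul, ← neg_smul, smul_mul_assoc, hEe]
        congr 1
        ring)
    refine re_weight_mul_eq_zero hN hζ hs hg
      (h := ∑ k ∈ Finset.range N, C ((N : ℚ)⁻¹ * (M * Q ^ k).trace) * X ^ k) ?_
    rw [he, isotypicProj, mul_smul_comm, Matrix.trace_smul, Finset.mul_sum, Matrix.trace_sum,
      Finset.smul_sum, map_sum]
    refine Finset.sum_congr rfl fun k _ ↦ ?_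
    rw [mul_smul_comm, Matrix.trace_smul, ← map_pow, ← map_mul, htr]
    simp
    ring
  have hsum : ((M * (4 + P + 3 * P ^ 3)).trace : ℂ) =
      ∑ i ∈ Finset.range N, (4 + ω ^ i + 3 * (ω ^ i) ^ 3) * (φ M * e (ω ^ i)).trace := by
    rw [← htr, ← mul_one (φ _), ← sum_isotypicProj (Q := φ Q) hN hω, Finset.mul_sum,
      Matrix.trace_sum]
    refine Finset.sum_congr rfl fun i _ ↦ ?_
    rw [← smul_eq_mul (a := 4 + ω ^ i + 3 * (ω ^ i) ^ 3), ← Matrix.trace_smul]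
    congr 1
    have h1 := hPe (ω ^ i) (hroot i)
    set ζ := ω ^ i
    change φ _ * e ζ = _
    have h3 : φ P ^ 3 * e ζ = ζ ^ 3 • e ζ := by
      rw [pow_succ, pow_two, mul_assoc, h1, mul_smul_comm, mul_assoc, h1, mul_smul_comm, h1,
        smul_smul, smul_smul, pow_succ, pow_two, mul_assoc]
    rw [map_mul, mul_assoc, ← mul_smul_comm]
    congr 1
    simp only [map_add, map_mul, map_pow, map_ofNat, add_mul, mul_assoc, h1, h3]
    rw [show (3 : Matrix V V ℂ) = algebraMap ℂ _ 3 from (map_ofNat _ 3).symm,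
      show (4 : Matrix V V ℂ) = algebraMap ℂ _ 4 from (map_ofNat _ 4).symm, ← Algebra.smul_def, ← Algebra.smul_def,
      smul_smul, add_smul, add_smul]
  have hre := congrArg Complex.re hsum
  rw [Complex.re_sum, Finset.sum_eq_zero fun i _ ↦ hterm _ (hroot i), Complex.ratCast_re] at hre
  exact_mod_cast hre

end

/-! ### Matrices satisfying `A ^ 2 + A + 1 + P = J` -/

open Matrix in
/-- A matrix with constant row sums maps the all-ones matrix to a multiple of itself. -/
theorem Matrix.mul_ones {V : Type*} [Fintype V] (X : Matrix V V ℚ) (c : ℚ)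
    (h : ∀ x, ∑ y, X x y = c) : X * of (fun _ _ ↦ 1) = c • of (fun _ _ ↦ 1) := by
  ext x y
  simp [mul_apply, h]

open Matrix in
theorem Matrix.ones_mul {V : Type*} [Fintype V] (X : Matrix V V ℚ) (c : ℚ)
    (h : ∀ y, ∑ x, X x y = c) : of (fun _ _ ↦ 1) * X = c • of (fun _ _ ↦ 1) := by
  ext x y
  simp [mul_apply, h]

theorem Matrix.mul_nonneg_entries {V : Type*} [Fintype V] {X Y : Matrix V V ℚ}
    (hX : ∀ x y, 0 ≤ X x y) (hY : ∀ x y, 0 ≤ Y x y) (x y : V) : 0 ≤ (X * Y) x y :=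
  Finset.sum_nonneg fun z _ ↦ mul_nonneg (hX x z) (hY z y)

theorem Matrix.trace_nonneg_of_entries {V : Type*} [Fintype V] {X : Matrix V V ℚ}
    (hX : ∀ x y, 0 ≤ X x y) : 0 ≤ X.trace :=
  Finset.sum_nonneg fun z _ ↦ hX z z

open Matrix in
/-- Put `B = 2 * A + 1`, so that `B * B = 4 * J - 3 - 4 * P` with `J` the all-ones matrix. On the
complement of the constant vectors the weighted trace of `B` vanishes, so the trace of
`B * (4 + P + 3 * P ^ 3)` is the contribution `8 * (2 * d + 1)` of the constant vectors. Since all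
entries are nonnegative and the diagonal of `B` is at least one, it is also at least
`4 * card V`. -/
theorem card_le_of_sq_add_self_add_one_add_eq_ones {V : Type*} [Fintype V] [DecidableEq V]
    [Nonempty V] {d : ℚ} {N : ℕ} (hN : N ≠ 0) {A P : Matrix V V ℚ}
    (hA : ∀ x y, 0 ≤ A x y) (hP : ∀ x y, 0 ≤ P x y) (hPN : P ^ N = 1)
    (hArow : ∀ x, ∑ y, A x y = d) (hAcol : ∀ y, ∑ x, A x y = d)
    (hProw : ∀ x, ∑ y, P x y = 1) (hPcol : ∀ y, ∑ x, P x y = 1)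
    (heq : A * A + A + 1 + P = of fun _ _ ↦ 1) : (Fintype.card V : ℚ) ≤ 4 * d + 2 := by
  set n : ℚ := (Fintype.card V : ℚ) with hn
  have hn0 : n ≠ 0 := by rw [hn]; exact_mod_cast Fintype.card_ne_zero
  have hAJ := mul_ones A d hArow
  have hJA := ones_mul A d hAcol
  have hPJ := mul_ones P 1 hProw
  have hJP := ones_mul P 1 hPcol
  have hJJ := mul_ones (of fun _ _ : V ↦ (1 : ℚ)) n (by simp [hn])
  rw [one_smul] at hPJ hJP
  set J : Matrix V V ℚ := of fun _ _ ↦ 1 with hJ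
  have hPeq : P = J - A * A - A - 1 := by rw [← heq]; abel
  have hAP : Commute A P := by
    have hc : Commute A J := by rw [Commute, SemiconjBy, hAJ, hJA]
    rw [hPeq]
    exact (((hc.sub_right ((Commute.refl A).mul_right (Commute.refl A))).sub_right
      (Commute.refl A)).sub_right (Commute.one_right A))
  -- The projection along the constant vectors.
  set E : Matrix V V ℚ := 1 - n⁻¹ • J with hEdef
  have hEJ : E * J = 0 := by
    rw [hEdef, sub_mul, one_mul, smul_mul_assoc, hJJ, smul_smul, inv_mul_cancel₀ hn0, one_smul,
      sub_self]
  have hE : IsIdempotentElem E := by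
    rw [IsIdempotentElem]
    conv_lhs => rw [hEdef, mul_sub, mul_one, ← hEdef, mul_smul_comm, hEJ, smul_zero, sub_zero]
  have hEP : Commute E P := by
    have hc : Commute J P := by rw [Commute, SemiconjBy, hPJ, hJP]
    exact (Commute.one_left P).sub_left (hc.smul_left _)
  have hEA : Commute E A := by
    have hc : Commute J A := by rw [Commute, SemiconjBy, hAJ, hJA]
    exact (Commute.one_left A).sub_left (hc.smul_left _)
  set B : Matrix V V ℚ := 2 * A + 1 with hB
  have hBB : B * B = 4 * J - (3 + 4 * P) := by
    rw [hPeq, hB, show (3 : Matrix V V ℚ) = 1 + 1 + 1 by norm_num]; noncomm_ring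
  have hEB : Commute E B :=
    ((Nat.cast_commute 2 E).symm.mul_right hEA).add_right (Commute.one_right E)
  have hBP : Commute B P :=
    ((Nat.cast_commute 2 P).mul_left hAP).add_left (Commute.one_left P)
  have key := trace_weight_eq_zero (M := B * E) hN hPN hE hEP (hBP.mul_left hEP)
    (by rw [← mul_assoc, hEB.eq, mul_assoc, hE.eq]) (by rw [mul_assoc, hE.eq])
    (by
      rw [mul_assoc, ← mul_assoc E, hEB.eq, mul_assoc, hE.eq, ← mul_assoc, hBB, sub_mul,
        mul_assoc, show J * E = 0 by
          rw [hEdef, mul_sub, mul_one, mul_smul_comm, hJJ, smul_smul, inv_mul_cancel₀ hn0,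
            one_smul, sub_self], mul_zero, zero_sub, neg_mul])
  have hJf : J * (4 + P + 3 * P ^ 3) = (8 : ℚ) • J := by
    have h3 : J * P ^ 3 = J := by rw [pow_succ, pow_two, ← mul_assoc, ← mul_assoc, hJP, hJP, hJP]
    have : J * (4 + P + 3 * P ^ 3) = 4 * J + J * P + 3 * (J * P ^ 3) := by noncomm_ring
    rw [this, hJP, h3, show (8 : ℚ) • J = 8 * J by
      rw [Algebra.smul_def, map_ofNat]]
    noncomm_ring
  have hBJ : B * J = (2 * d + 1) • J := by
    rw [hB, add_mul, mul_assoc, hAJ, one_mul, add_smul, one_smul, two_mul, two_mul, add_smul]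
  have htrJ : J.trace = n := by simp [hJ, Matrix.trace, hn]
  have hsplit : B * E * (4 + P + 3 * P ^ 3) =
      B * (4 + P + 3 * P ^ 3) - (8 * (2 * d + 1) * n⁻¹) • J := by
    rw [hEdef, mul_sub, mul_one, mul_smul_comm, hBJ, sub_mul, smul_mul_assoc, smul_mul_assoc, hJf,
      smul_smul, smul_smul]
    congr 2
    ring
  rw [hsplit, trace_sub, trace_smul, htrJ, smul_eq_mul, inv_mul_cancel_right₀ hn0] at key
  have hB0 : ∀ x y, 0 ≤ B x y := by
    intro x y
    rw [hB, two_mul, Matrix.add_apply, Matrix.add_apply, Matrix.one_apply]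
    have := hA x y
    split_ifs <;> linarith
  have hexp : B * (4 + P + 3 * P ^ 3) = (4 : ℚ) • B + B * P + (3 : ℚ) • (B * (P * P * P)) := by
    have h4 : (4 : ℚ) • B = 4 * B := by rw [Algebra.smul_def, map_ofNat]
    have h3 : (3 : ℚ) • (B * (P * P * P)) = 3 * (B * (P * P * P)) := by
      rw [Algebra.smul_def, map_ofNat]
    rw [h3, h4]
    noncomm_ring
  have h1 : 0 ≤ (B * P).trace := trace_nonneg_of_entries (mul_nonneg_entries hB0 hP)
  have h2 : 0 ≤ (B * (P * P * P)).trace := trace_nonneg_of_entries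
    (mul_nonneg_entries hB0 (mul_nonneg_entries (mul_nonneg_entries hP hP) hP))
  have h3 : n ≤ B.trace := by
    have : 0 ≤ A.trace := trace_nonneg_of_entries hA
    rw [hB, two_mul, trace_add, trace_add, trace_one]
    linarith
  rw [hexp, trace_add, trace_add, trace_smul, trace_smul, smul_eq_mul, smul_eq_mul] at key
  linarith

open Matrix in
/-- If all rows of `P * A` agree, then `A ^ 3 + A ^ 2 + A` vanishes modulo the constant vectors. There
`-(A ^ 2 + A)` is a projection, on the image of which `2 * A + 1` squares to `-3`; being rational,
it has trace zero on this image. The vanishing of the traces of `A` and `A ^ 2` turns this into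
`d ^ 2 - d = 0`. -/
theorem sq_eq_self_of_rows_eq {V : Type*} [Fintype V] [DecidableEq V]
    [Nonempty V] {d : ℚ} (hd : 0 < d) {A P : Matrix V V ℚ}
    (hArow : ∀ x, ∑ y, A x y = d) (hPA : ∀ x x' y, (P * A) x y = (P * A) x' y)
    (heq : A * A + A + 1 + P = of fun _ _ ↦ 1) (htr : A.trace = 0) (htr2 : (A * A).trace = 0) :
    d ^ 2 = d := by
  set κ : ℚ := d ^ 3 + d ^ 2 + d with hκ
  have hκ0 : κ ≠ 0 := by positivity
  set R : Matrix V V ℚ := A * A * A + A * A + A with hR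
  have hRows : ∀ x x' y, R x y = R x' y := by
    have : R = (of fun _ _ ↦ 1) * A - P * A := by
      rw [← heq, hR]; noncomm_ring
    intro x x' y
    rw [this, Matrix.sub_apply, Matrix.sub_apply, hPA x x' y]
    simp [mul_apply]
  have hAR : A * R = d • R := by
    ext x y
    rw [mul_apply, Finset.sum_congr rfl fun z _ ↦ by rw [hRows z x y], ← Finset.sum_mul, hArow,
      Matrix.smul_apply, smul_eq_mul]
  have hRA : R * A = d • R := by
    rw [← hAR, hR]; noncomm_ring
  have htrR : R.trace = κ := by
    have hAJ := mul_ones A d hArow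
    obtain ⟨x₀⟩ := ‹Nonempty V›
    have h1 : R * (of fun _ _ ↦ 1) = κ • (of fun _ _ ↦ 1) := by
      rw [hR, add_mul, add_mul, mul_assoc, mul_assoc, mul_assoc, hAJ]
      simp only [mul_smul_comm, hAJ, smul_smul, hκ]
      module
    have h2 := congrFun (congrFun h1 x₀) x₀
    simp [mul_apply] at h2
    rw [Matrix.trace, ← h2]
    exact Finset.sum_congr rfl fun y _ ↦ hRows y x₀ y
  -- The projection onto the constant vectors that commutes with `A`; the matrix `C` below is `A` with
  -- this eigenspace removed.
  set T : Matrix V V ℚ := κ⁻¹ • R with hT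
  have hAT : A * T = d • T := by rw [hT, mul_smul_comm, hAR, smul_comm]
  have hTA : T * A = d • T := by rw [hT, smul_mul_assoc, hRA, smul_comm]
  have hRT : R = κ • T := by rw [hT, smul_smul, mul_inv_cancel₀ hκ0, one_smul]
  have hRmulT : R * T = κ • T := by
    rw [hR]
    simp only [add_mul, mul_assoc, hAT, mul_smul_comm, smul_smul, hκ]
    module
  have hTT : T * T = T := by
    conv_lhs => rw [hT, smul_mul_assoc, ← hT, hRmulT, smul_smul, inv_mul_cancel₀ hκ0, one_smul]
  have htrT : T.trace = 1 := by
    rw [hT, trace_smul, htrR, smul_eq_mul, inv_mul_cancel₀ hκ0]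
  clear_value T
  set C : Matrix V V ℚ := A - d • T with hC
  have hC2 : C * C = A * A - (d ^ 2) • T := by
    rw [hC]
    simp only [sub_mul, mul_sub, smul_mul_assoc, mul_smul_comm, hAT, hTA, hTT]
    module
  have hC3 : C * C * C = - (C * C) - C := by
    have h3 : C * C * C = A * A * A - d ^ 3 • T := by
      rw [hC2, hC]
      simp only [sub_mul, mul_sub, smul_mul_assoc, mul_smul_comm, mul_assoc, hAT, hTA, hTT]
      module
    have : A * A * A = κ • T - A * A - A := by rw [← hRT, hR]; abel
    rw [h3, this, hC2, hC, hκ]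
    module
  have hC3' : C * (C * C) = - (C * C) - C := by rw [← mul_assoc, hC3]
  set φ : Matrix V V ℚ →+* Matrix V V ℂ := (algebraMap ℚ ℂ).mapMatrix with hφ
  have htrφ (X : Matrix V V ℚ) : (φ X).trace = (X.trace : ℂ) := by
    simp [hφ, Matrix.trace]
  obtain ⟨s, hs⟩ := IsAlgClosed.exists_pow_nat_eq (-3 : ℂ) (n := 2) (by norm_num)
  have hs0 : s ≠ 0 := by rintro rfl; norm_num at hs
  obtain ⟨g, hg⟩ := exists_trace_eq_int_mul (E := φ (-(C * C) - C)) (F := φ (C - C * C)) hs0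
    (by
      rw [IsIdempotentElem, ← map_mul]
      congr 1
      simp only [sub_mul, mul_sub, neg_mul, mul_neg, mul_assoc, hC3']
      abel)
    (by
      rw [← map_mul]
      congr 1
      simp only [sub_mul, mul_sub, neg_mul, mul_neg, mul_assoc, hC3']
      abel)
    (by
      rw [← map_mul]
      congr 1
      simp only [sub_mul, mul_sub, mul_neg, mul_assoc, hC3']
      abel)
    (by
      rw [← map_mul, hs, show (-3 : ℂ) • φ (-(C * C) - C) = φ (-3 * (-(C * C) - C)) by
        rw [map_mul, Algebra.smul_def]
        simp only [map_neg, map_ofNat]]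
      congr 1
      simp only [sub_mul, mul_sub, neg_mul, mul_neg, mul_assoc, hC3']
      noncomm_ring)
  have htrF : (C - C * C).trace = d ^ 2 - d := by
    rw [trace_sub, hC2, hC, trace_sub, trace_sub, trace_smul, trace_smul, htr, htr2, htrT]
    simp only [smul_eq_mul]
    ring
  rw [htrφ, htrF] at hg
  -- The trace is rational, whereas `s` is purely imaginary.
  have hsq : (((d ^ 2 - d) ^ 2 : ℚ) : ℂ) = ((-3 * (g : ℚ) ^ 2 : ℚ) : ℂ) := by
    push_cast at hg ⊢
    rw [hg, mul_pow, hs]; ring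
  have hsq' : (d ^ 2 - d) ^ 2 = -3 * (g : ℚ) ^ 2 := by exact_mod_cast hsq
  nlinarith [sq_nonneg (d ^ 2 - d), sq_nonneg (g : ℚ)]

/-! ### Digraphs of excess one -/

namespace Digraph

section Geodetic

variable {V : Type*} {G : Digraph V}

theorem IsGeodetic.not_adj_self (h : G.IsGeodetic 2) (x : V) : ¬ G.Adj x x := fun hx ↦ by
  simpa using h x x .nil (.cons hx .nil) (by simp [Walk.length]) (by simp [Walk.length])

theorem IsGeodetic.ne_of_adj_of_adj (h : G.IsGeodetic 2) {x y z : V} (hxy : G.Adj x y)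
    (hyz : G.Adj y z) : x ≠ z := by
  rintro rfl
  simpa using h x x .nil (.cons hxy (.cons hyz .nil)) (by simp [Walk.length])
    (by simp [Walk.length])

theorem IsGeodetic.not_adj_of_adj_of_adj (h : G.IsGeodetic 2) {x y z : V} (hxy : G.Adj x y)
    (hyz : G.Adj y z) : ¬ G.Adj x z := fun hxz ↦ by
  have := h x z (.cons hxz .nil) (.cons hxy (.cons hyz .nil)) (by simp [Walk.length])
    (by simp [Walk.length])
  have := congrArg Walk.length this
  simp [Walk.length] at this

theorem IsGeodetic.eq_of_adj_of_adj (h : G.IsGeodetic 2) {x y y' z : V} (hxy : G.Adj x y)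
    (hyz : G.Adj y z) (hxy' : G.Adj x y') (hyz' : G.Adj y' z) : y = y' := by
  have := h x z (.cons hxy (.cons hyz .nil)) (.cons hxy' (.cons hyz' .nil)) (by simp [Walk.length])
    (by simp [Walk.length])
  injection this

end Geodetic

open Classical in
/-- The adjacency matrix of a digraph, with rational entries. -/
noncomputable def adjMat {V : Type*} (G : Digraph V) : Matrix V V ℚ :=
  Matrix.of fun x y ↦ if G.Adj x y then 1 else 0

section AdjMat

variable {V : Type*} {G : Digraph V}

theorem adjMat_of_adj {x y : V} (h : G.Adj x y) : G.adjMat x y = 1 := by simp [adjMat, h]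

theorem adjMat_of_not_adj {x y : V} (h : ¬ G.Adj x y) : G.adjMat x y = 0 := by simp [adjMat, h]

theorem adjMat_nonneg (x y : V) : 0 ≤ G.adjMat x y := by
  by_cases h : G.Adj x y
  · simp [adjMat_of_adj h]
  · simp [adjMat_of_not_adj h]

theorem adjMat_le_one (x y : V) : G.adjMat x y ≤ 1 := by
  by_cases h : G.Adj x y
  · simp [adjMat_of_adj h]
  · simp [adjMat_of_not_adj h]

variable [Fintype V]

theorem sum_adjMat_row (x : V) : ∑ y, G.adjMat x y = G.outDegree x := by
  classical
  simp only [adjMat, Matrix.of_apply, Finset.sum_boole, outDegree]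
  rw [Set.ncard_eq_toFinset_card']
  simp

theorem exists_sum_adjMat_col_eq_natCast (y : V) : ∃ c : ℕ, ∑ x, G.adjMat x y = c := by
  classical
  simp only [adjMat, Matrix.of_apply, Finset.sum_boole]
  exact ⟨_, rfl⟩

variable {d : ℕ}

theorem IsExcessOne.card_eq (h : G.IsExcessOne d 2) : Fintype.card V = d ^ 2 + d + 2 := by
  rw [h.order, mooreBound]
  simp [Finset.sum_range_succ]
  ring

theorem IsGeodetic.trace_adjMat (h : G.IsGeodetic 2) : G.adjMat.trace = 0 :=
  Finset.sum_eq_zero fun x _ ↦ adjMat_of_not_adj (h.not_adj_self x)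

theorem IsGeodetic.trace_adjMat_mul_self (h : G.IsGeodetic 2) :
    (G.adjMat * G.adjMat).trace = 0 := by
  refine Finset.sum_eq_zero fun x _ ↦ ?_
  rw [Matrix.diag_apply, Matrix.mul_apply]
  refine Finset.sum_eq_zero fun y _ ↦ ?_
  by_cases h1 : G.Adj x y
  · rw [adjMat_of_not_adj fun h2 ↦ h.ne_of_adj_of_adj h1 h2 rfl, mul_zero]
  · rw [adjMat_of_not_adj h1, zero_mul]

variable [DecidableEq V]

/-- The entries of `A ^ 2 + A + 1` count walks of length at most two. -/
theorem IsGeodetic.adjMat_eq_zero_or_one (h : G.IsGeodetic 2) (x z : V) :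
    (G.adjMat * G.adjMat + G.adjMat + 1) x z = 0 ∨
      (G.adjMat * G.adjMat + G.adjMat + 1) x z = 1 := by
  rw [Matrix.add_apply, Matrix.add_apply, Matrix.mul_apply]
  by_cases hw : ∃ y, G.Adj x y ∧ G.Adj y z
  · obtain ⟨y, hxy, hyz⟩ := hw
    right
    rw [Finset.sum_eq_single y, adjMat_of_adj hxy, adjMat_of_adj hyz,
      adjMat_of_not_adj (h.not_adj_of_adj_of_adj hxy hyz),
      Matrix.one_apply_ne (h.ne_of_adj_of_adj hxy hyz)]
    · norm_num
    · intro y' _ hne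
      by_cases h1 : G.Adj x y'
      · by_cases h2 : G.Adj y' z
        · exact absurd (h.eq_of_adj_of_adj h1 h2 hxy hyz) hne
        · rw [adjMat_of_not_adj h2, mul_zero]
      · rw [adjMat_of_not_adj h1, zero_mul]
    · simp
  · have h0 : ∑ y, G.adjMat x y * G.adjMat y z = 0 := by
      refine Finset.sum_eq_zero fun y _ ↦ ?_
      by_cases h1 : G.Adj x y
      · rw [adjMat_of_not_adj fun h2 ↦ hw ⟨y, h1, h2⟩, mul_zero]
      · rw [adjMat_of_not_adj h1, zero_mul]
    rw [h0]
    by_cases hxz : G.Adj x z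
    · rw [adjMat_of_adj hxz, Matrix.one_apply_ne (show x ≠ z by rintro rfl; exact h.not_adj_self x hxz)]
      norm_num
    · rw [adjMat_of_not_adj hxz, Matrix.one_apply]
      split_ifs <;> norm_num

theorem sum_adjMat_poly_row (x : V) :
    ∑ z, (G.adjMat * G.adjMat + G.adjMat + 1) x z =
      ∑ y, G.adjMat x y * G.outDegree y + G.outDegree x + 1 := by
  simp only [Matrix.add_apply, Finset.sum_add_distrib, Matrix.mul_apply]
  rw [Finset.sum_comm]
  simp only [← Finset.mul_sum, sum_adjMat_row]
  congr 1
  simp [Matrix.one_apply]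

/-- A vertex of out-degree larger than `d` would reach too many vertices. -/
theorem IsExcessOne.outDegree_eq (h : G.IsExcessOne d 2) (hd : 0 < d) (x : V) :
    G.outDegree x = d := by
  have hle : ∀ y, d ≤ G.outDegree y := fun y ↦ h.minOutDegree.2 ⟨y, rfl⟩
  refine le_antisymm ?_ (hle x)
  by_contra! hlt
  have h1 : ∑ z, (G.adjMat * G.adjMat + G.adjMat + 1) x z ≤ (d : ℚ) ^ 2 + d + 2 := by
    calc ∑ z, (G.adjMat * G.adjMat + G.adjMat + 1) x z ≤ ∑ _z : V, (1 : ℚ) :=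
          Finset.sum_le_sum fun z _ ↦ by
            rcases h.isGeodetic.adjMat_eq_zero_or_one x z with h | h
            · exact h.le.trans zero_le_one
            · exact h.le
      _ = (d : ℚ) ^ 2 + d + 2 := by simp [h.card_eq]
  have h2 : ∑ y, G.adjMat x y * (d : ℚ) ≤ ∑ y, G.adjMat x y * G.outDegree y :=
    Finset.sum_le_sum fun y _ ↦
      mul_le_mul_of_nonneg_left (Nat.cast_le.2 (hle y)) (adjMat_nonneg x y)
  rw [sum_adjMat_poly_row] at h1
  rw [← Finset.sum_mul, sum_adjMat_row] at h2
  have h3 : (d : ℚ) + 1 ≤ G.outDegree x := by exact_mod_cast hlt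
  have h4 : (0 : ℚ) < d := by exact_mod_cast hd
  nlinarith

/-- Every vertex `x` has a unique outlier `o x`, the one vertex not reached from `x` by a walk of
length at most two. -/
theorem IsExcessOne.exists_outlier (h : G.IsExcessOne d 2) (hd : 0 < d) :
    ∃ o : V → V, G.adjMat * G.adjMat + G.adjMat + 1 +
      Matrix.of (fun x y ↦ if o x = y then (1 : ℚ) else 0) = Matrix.of fun _ _ ↦ 1 := by
  have hrow (x : V) : ∑ z, (1 - (G.adjMat * G.adjMat + G.adjMat + 1) x z) = 1 := by
    rw [Finset.sum_sub_distrib, sum_adjMat_poly_row]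
    simp only [h.outDegree_eq hd, ← Finset.sum_mul, sum_adjMat_row]
    simp [h.card_eq]
    ring
  have hex (x : V) : ∃ y, ∀ z, 1 - (G.adjMat * G.adjMat + G.adjMat + 1) x z =
      if y = z then 1 else 0 := by
    have hn (z : V) : 0 ≤ 1 - (G.adjMat * G.adjMat + G.adjMat + 1) x z := by
      rcases h.isGeodetic.adjMat_eq_zero_or_one x z with h | h <;> rw [h] <;> norm_num
    obtain ⟨y, -, hy⟩ := Finset.exists_ne_zero_of_sum_ne_zero ((hrow x).trans_ne one_ne_zero)
    have hy1 : 1 - (G.adjMat * G.adjMat + G.adjMat + 1) x y = 1 := by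
      rcases h.isGeodetic.adjMat_eq_zero_or_one x y with h | h
      · rw [h, sub_zero]
      · rw [h, sub_self] at hy
        exact absurd rfl hy
    refine ⟨y, fun z ↦ ?_⟩
    split_ifs with hyz
    · rw [← hyz, hy1]
    · have h0 := hrow x
      rw [← Finset.add_sum_erase _ _ (Finset.mem_univ y), hy1] at h0
      have h1 : ∑ z ∈ Finset.univ.erase y, (1 - (G.adjMat * G.adjMat + G.adjMat + 1) x z) = 0 := by
        linarith
      exact (Finset.sum_eq_zero_iff_of_nonneg fun z _ ↦ hn z).1 h1 z
        (Finset.mem_erase.2 ⟨Ne.symm hyz, Finset.mem_univ z⟩)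
  choose o ho using hex
  refine ⟨o, Matrix.ext fun x y ↦ ?_⟩
  rw [Matrix.add_apply, Matrix.of_apply, Matrix.of_apply, ← ho x y]
  ring

/-- A digraph of excess one is regular. Multiplying `A ^ 2 + A + 1 + P = J` by `A` from both sides
expresses the number of out-neighbours of `u` with outlier `v` as `A (o u) v + d - c v`, where `c`
is the in-degree. So if `v` lies in the set `S` of vertices with `c v > d`, then `c v = d + 1`, every
outlier is adjacent to `v`, and no out-neighbour of any vertex has outlier `v`. Counting in-degrees
shows that `S` has `d` elements if it is nonempty, so it is the out-neighbourhood of every outlier.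
Thus all rows of `P * A` agree, which is impossible for `d ≥ 2`. -/
theorem IsExcessOne.sum_adjMat_col (h : G.IsExcessOne d 2) (hd : 2 ≤ d) (v : V) :
    ∑ u, G.adjMat u v = d := by
  classical
  obtain ⟨o, ho⟩ := h.exists_outlier (by omega)
  set P : Matrix V V ℚ := Matrix.of (fun x y ↦ if o x = y then (1 : ℚ) else 0) with hP
  set A := G.adjMat
  have hrow : ∀ x, ∑ y, A x y = d := fun x ↦ by rw [sum_adjMat_row, h.outDegree_eq (by omega)]
  have hP0 : ∀ x y, 0 ≤ P x y := fun x y ↦ by rw [hP, Matrix.of_apply]; split_ifs <;> norm_num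
  have hcard : (Fintype.card V : ℚ) = d ^ 2 + d + 2 := by exact_mod_cast h.card_eq
  have hPA : ∀ u v, (P * A) u v = A (o u) v := fun u v ↦ by
    simp [hP, Matrix.mul_apply]
  set c : V → ℚ := fun v ↦ ∑ u, A u v with hc
  have hcommA : ∀ u v, (A * P) u v = A (o u) v + d - c v := by
    intro u v
    have h1 : A * (A * A + A + 1 + P) = (A * A + A + 1) * A + A * P := by noncomm_ring
    have h2 : (A * A + A + 1 + P) * A = (A * A + A + 1) * A + P * A := by noncomm_ring
    rw [ho] at h1 h2
    have e1 := congrFun (congrFun h1 u) v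
    have e2 := congrFun (congrFun h2 u) v
    rw [Matrix.mul_apply, Matrix.add_apply] at e1 e2
    simp only [Matrix.of_apply, mul_one, one_mul, hrow, hPA] at e1 e2
    change c v = _ at e2
    linarith
  have hAP0 : ∀ u v, 0 ≤ (A * P) u v := Matrix.mul_nonneg_entries adjMat_nonneg hP0
  have hV : Nonempty V := ⟨v⟩
  have hcsum : ∑ v, (d - c v) = 0 := by
    rw [Finset.sum_sub_distrib, hc, Finset.sum_comm]
    simp [hrow]
  -- `S` is the set of vertices of too large an in-degree.
  set S : Finset V := Finset.univ.filter fun v ↦ (d : ℚ) < c v with hS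
  have hmem : ∀ v, v ∈ S ↔ (d : ℚ) < c v := by simp [hS]
  rcases S.eq_empty_or_nonempty with hempty | hne
  · have hle : ∀ v, 0 ≤ d - c v := fun v ↦ by
      have : v ∉ S := by simp [hempty]
      rw [hmem] at this
      linarith
    have := (Finset.sum_eq_zero_iff_of_nonneg fun v _ ↦ hle v).1 hcsum v (Finset.mem_univ v)
    change c v = d
    linarith
  exfalso
  have hSprop : ∀ v ∈ S, c v = d + 1 ∧ ∀ u, A (o u) v = 1 ∧ (A * P) u v = 0 := by
    intro v hv
    rw [hmem] at hv
    obtain ⟨m, hm⟩ := exists_sum_adjMat_col_eq_natCast (G := G) v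
    change c v = m at hm
    have h1 : (d : ℚ) + 1 ≤ c v := by rw [hm] at hv ⊢; exact_mod_cast hv
    have h2 : ∀ u, A (o u) v = 1 ∧ (A * P) u v = 0 ∧ c v = d + 1 := by
      intro u
      have e1 := hcommA u v
      have e2 := hAP0 u v
      have e3 : A (o u) v ≤ 1 := adjMat_le_one _ _
      exact ⟨by linarith, by linarith, by linarith⟩
    exact ⟨(h2 v).2.2, fun u ↦ ⟨(h2 u).1, (h2 u).2.1⟩⟩
  -- The in-degrees have mean `d`, so the total deficiency outside `S` equals the excess on `S`.
  have hdef : ∑ v ∈ Finset.univ.filter (· ∉ S), (d - c v) = S.card := by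
    have h1 := Finset.sum_filter_add_sum_filter_not Finset.univ (· ∈ S) (fun v ↦ d - c v)
    rw [hcsum, Finset.filter_univ_mem,
      Finset.sum_congr rfl fun v hv ↦ by rw [(hSprop v hv).1]] at h1
    simp at h1
    simpa using (eq_neg_of_add_eq_zero_right h1)
  have hdef0 : ∀ v ∈ Finset.univ.filter (· ∉ S), 0 ≤ d - c v := by
    intro v hv
    have := (hmem v).not.1 (Finset.mem_filter.1 hv).2
    linarith
  have hge : (d : ℚ) ≤ S.card := by
    -- A vertex of in-degree zero alone accounts for a deficiency of `d`. Otherwise no vertex has an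
    -- outlier in `S`, and the deficiency is found among the in-neighbours of a vertex of `S`.
    by_cases hz : ∃ z, c z = 0
    · obtain ⟨z, hz⟩ := hz
      rw [← hdef]
      have hzS : z ∉ S := by rw [hmem, hz]; simp
      have := Finset.single_le_sum hdef0 (Finset.mem_filter.2 ⟨Finset.mem_univ z, hzS⟩)
      rw [hz] at this
      linarith
    · push Not at hz
      obtain ⟨v, hv⟩ := hne
      have hcol : ∑ u, P u v = 0 := by
        refine Finset.sum_eq_zero fun w _ ↦ ?_
        obtain ⟨u, -, hu⟩ := Finset.exists_ne_zero_of_sum_ne_zero (hz w)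
        have h1 := ((hSprop v hv).2 u).2
        rw [Matrix.mul_apply, Finset.sum_eq_zero_iff_of_nonneg fun w _ ↦
          mul_nonneg (adjMat_nonneg _ _) (hP0 _ _)] at h1
        exact (mul_eq_zero.1 (h1 w (Finset.mem_univ w))).resolve_left hu
      -- The vertices reaching `v` by walks of length at most two, together with those whose outlier is
      -- `v`, are all the vertices.
      have hball : ∑ w, c w * A w v + c v + 1 + ∑ u, P u v = d ^ 2 + d + 2 := by
        have := congrArg (fun X : Matrix V V ℚ ↦ ∑ u, X u v) ho
        simp only [Matrix.add_apply, Finset.sum_add_distrib, Matrix.mul_apply] at this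
        rw [Finset.sum_comm] at this
        simp only [← Finset.sum_mul] at this
        simpa [Matrix.one_apply, hcard] using this
      rw [hcol, (hSprop v hv).1] at hball
      have h1 : ∑ w, A w v * (d - c w) = d := by
        have : ∀ w, A w v * (d - c w) = A w v * d - c w * A w v := fun w ↦ by ring
        simp only [this]
        rw [Finset.sum_sub_distrib, ← Finset.sum_mul]
        change c v * d - _ = _
        rw [(hSprop v hv).1]
        linarith
      rw [← hdef, ← h1, Finset.sum_filter]
      refine Finset.sum_le_sum fun w _ ↦ ?_
      have ha0 : 0 ≤ A w v := adjMat_nonneg _ _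
      have ha1 : A w v ≤ 1 := adjMat_le_one _ _
      split_ifs with hw
      · have := (hmem w).1 hw
        nlinarith
      · have := hdef0 w (Finset.mem_filter.2 ⟨Finset.mem_univ w, hw⟩)
        nlinarith
  -- Every outlier dominates `S`, which has as many vertices as its out-neighbourhood.
  have hrows : ∀ u y, A (o u) y = if y ∈ S then 1 else 0 := by
    intro u
    have h0 : ∀ y ∈ Finset.univ.filter (· ∉ S), 0 ≤ A (o u) y := fun y _ ↦ adjMat_nonneg _ _
    have h1 := Finset.sum_filter_add_sum_filter_not Finset.univ (· ∈ S) (fun y ↦ A (o u) y)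
    rw [hrow, Finset.filter_univ_mem,
      Finset.sum_congr rfl fun v hv ↦ ((hSprop v hv).2 u).1] at h1
    simp only [Finset.sum_const, nsmul_one] at h1
    have h2 := Finset.sum_nonneg h0
    intro y
    split_ifs with hy
    · exact ((hSprop y hy).2 u).1
    · exact (Finset.sum_eq_zero_iff_of_nonneg h0).1 (by linarith) y
        (Finset.mem_filter.2 ⟨Finset.mem_univ y, hy⟩)
  have hd2 : (2 : ℚ) ≤ d := by exact_mod_cast hd
  have := sq_eq_self_of_rows_eq (by linarith) hrow
    (fun x x' y ↦ by rw [hPA, hPA, hrows, hrows]) ho h.isGeodetic.trace_adjMat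
    h.isGeodetic.trace_adjMat_mul_self
  nlinarith

/-- By regularity the outlier map is a permutation, so the spectral bound applies. -/
theorem IsExcessOne.card_le (h : G.IsExcessOne d 2) (hd : 2 ≤ d) :
    Fintype.card V ≤ 4 * d + 2 := by
  obtain ⟨o, ho⟩ := h.exists_outlier (by omega)
  have hcard : (Fintype.card V : ℚ) = d ^ 2 + d + 2 := by exact_mod_cast h.card_eq
  have hV : Nonempty V := by
    rw [← Fintype.card_pos_iff, h.card_eq]; omega
  have hcol := h.sum_adjMat_col hd
  have hrow : ∀ x, ∑ y, G.adjMat x y = d := fun x ↦ by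
    rw [sum_adjMat_row, h.outDegree_eq (by omega)]
  have hPcol : ∀ v, ∑ u, (if o u = v then (1 : ℚ) else 0) = 1 := by
    intro v
    have := congrArg (fun X : Matrix V V ℚ ↦ ∑ u, X u v) ho
    simp only [Matrix.add_apply, Finset.sum_add_distrib, Matrix.mul_apply] at this
    rw [Finset.sum_comm] at this
    simp only [← Finset.sum_mul, hcol] at this
    rw [← Finset.mul_sum, hcol] at this
    simp only [Matrix.one_apply, Matrix.of_apply, Finset.sum_ite_eq', Finset.mem_univ, if_true,
      Finset.sum_const, Finset.card_univ, nsmul_one, hcard] at this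
    linarith
  have hsurj : Function.Surjective o := by
    intro v
    obtain ⟨u, -, hu⟩ := Finset.exists_ne_zero_of_sum_ne_zero ((hPcol v).trans_ne one_ne_zero)
    exact ⟨u, by simpa using hu⟩
  set σ : Equiv.Perm V := Equiv.ofBijective o (Finite.surjective_iff_bijective.1 hsurj) with hσ
  set P : Matrix V V ℚ := Matrix.of (fun x y ↦ if o x = y then (1 : ℚ) else 0) with hP
  have hPσ : P = Matrix.permMatrixHom (R := ℚ) σ⁻¹ := by
    rw [Matrix.permMatrixHom_apply, inv_inv]
    ext x y
    simp [hP, hσ, PEquiv.toMatrix_apply, Equiv.toPEquiv_apply, eq_comm]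
  have key := card_le_of_sq_add_self_add_one_add_eq_ones (orderOf_pos σ⁻¹).ne' adjMat_nonneg
    (P := P) (fun x y ↦ by rw [hP, Matrix.of_apply]; split_ifs <;> norm_num)
    (by rw [hPσ, ← map_pow, pow_orderOf_eq_one, map_one]) hrow hcol (fun x ↦ by simp [hP]) hPcol ho
  exact_mod_cast key

theorem not_isExcessOne_two (hd : 4 ≤ d) : ¬ G.IsExcessOne d 2 := by
  intro h
  have h1 := h.card_le (by omega)
  rw [h.card_eq] at h1
  nlinarith

end AdjMat

end Digraph

theorem mainTheorem2 {V : Type*} [Fintype V] (G : Digraph V) :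
    ¬ G.IsExcessOne 5 2 ∧ ¬ G.IsExcessOne 6 2 ∧ ¬ G.IsExcessOne 7 2 := by
  classical
  exact ⟨Digraph.not_isExcessOne_two (by norm_num), Digraph.not_isExcessOne_two (by norm_num),
    Digraph.not_isExcessOne_two (by norm_num)⟩
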